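/- Let $G:[0,\infty)\to[0,1]$ be the distribution function of a probability measure on $[0,\infty)$, and let $G^{-1}(p)=\inf\{x\ge 0: G(x)\ge p\}$ (with $\inf\emptyset=\infty$). Suppose that $G$ is controlled near $0$, that is, for some constant $c>1$, $$1<\liminf_{x\downarrow 0}\frac{G(cx)}{G(x)}\le\limsup_{x\downarrow 0}\frac{G(cx)}{G(x)}<\infty .$$ Let $f:\{0,1,2,\dots\}\to\{1,2,3,\dots\}$ be non-decreasing. Let $T_f$ be the spherically symmetric rooted tree in which every vertex of generation $n$ (at distance $n$ from the root) has exactly $f(n)$ children, and give its edges i.i.d. weights with distribution function $G$. Let $m_n$ be the minimum, over the vertices $v$ of generation $n$, of the sum of the weights on the path from the root to $v$. Call $f$ $G$-explosive if $\lim_{n\to\infty}m_n<\infty$ almost surely, and call $f$ $G$-small if the series $\sum_{n\ge 0}G^{-1}(1/f(n))$ converges, in the sense that $\sum_{n\ge N}G^{-1}(1/f(n))<\infty$ for some $N$ (equivalently, whenever all terms are finite, and in particular if $f(0)\ge 2$, that $\sum_{n\ge 0}G^{-1}(1/f(n))<\infty$). Then $f$ is $G$-small if and only if $f$ is $G$-explosive.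 -/

import Mathlib

open MeasureTheory Filter Topology
open scoped NNReal ENNReal

noncomputable section

namespace SphericalTree

/-! ### Weight distributions on `[0, ∞)`

A weight distribution is a probability measure `ν` on `ℝ≥0`; `distrib ν` is its (right-continuous)
distribution function, called `G` in the comments below. -/

/-- The distribution function `G(x) = ν [0, x]`. -/
def distrib (ν : Measure ℝ≥0) (x : ℝ≥0) : ℝ≥0∞ := ν (Set.Iic x)

/-- The generalized inverse (quantile function) `G⁻¹(p) = inf {x ≥ 0 : G(x) ≥ p}`, with
`inf ∅ = ∞`. -/
def quantile (ν : Measure ℝ≥0) (p : ℝ≥0∞) : ℝ≥0∞ :=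
  ⨅ (x : ℝ≥0) (_ : p ≤ distrib ν x), (x : ℝ≥0∞)

/-- `G` is controlled near `0`: for some constant `c > 1`,
`1 < liminf_{x → 0+} G(cx)/G(x) ≤ limsup_{x → 0+} G(cx)/G(x) < ∞`.
(With the convention `0 / 0 = 0` of `ℝ≥0∞`, a `G` that vanishes near `0` is not controlled.) -/
def ControlledNearZero (ν : Measure ℝ≥0) : Prop :=
  ∃ c : ℝ≥0, 1 < c ∧
    1 < liminf (fun x : ℝ≥0 => distrib ν (c * x) / distrib ν x) (𝓝[>] 0) ∧
    limsup (fun x : ℝ≥0 => distrib ν (c * x) / distrib ν x) (𝓝[>] 0) < ∞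

/-- `f` is `G`-small: the series `∑ G⁻¹(1 / f(n))` converges, i.e. some tail of it has a finite sum.
For `f(n) ≥ 2` every term is finite, and then this is finiteness of the whole sum
(`gSmall_iff_tsum_lt_top`). If `G` has unbounded support, then `G⁻¹(1) = ∞`, and passing to a tail
discards the finitely many infinite terms that come from initial values `f(n) = 1`. -/
def GSmall (ν : Measure ℝ≥0) (f : ℕ → ℕ) : Prop :=
  ∃ N : ℕ, ∑' n : ℕ, quantile ν ((f (n + N) : ℝ≥0∞)⁻¹) < ∞

/-- When all terms are finite, `f` is `G`-small iff `∑_{n ≥ 0} G⁻¹(1 / f(n)) < ∞`. -/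
theorem gSmall_iff_tsum_lt_top (ν : Measure ℝ≥0) (f : ℕ → ℕ)
    (h : ∀ n, quantile ν ((f n : ℝ≥0∞)⁻¹) ≠ ∞) :
    GSmall ν f ↔ ∑' n : ℕ, quantile ν ((f n : ℝ≥0∞)⁻¹) < ∞ := by
  constructor
  · rintro ⟨N, hN⟩
    rw [← ENNReal.summable.sum_add_tsum_nat_add' (k := N)]
    exact ENNReal.add_lt_top.2 ⟨ENNReal.sum_lt_top.2 fun n _ => (h n).lt_top, hN⟩
  · intro hs
    exact ⟨0, hs⟩

/-! ### The spherically symmetric tree `T_f` -/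

/-- The vertices of generation `n` of the spherically symmetric tree `T_f`: sequences
`(v₀, …, vₙ₋₁)` with `vᵢ ∈ {0, …, f(i) - 1}`. -/
abbrev Vertex (f : ℕ → ℕ) (n : ℕ) : Type := (i : Fin n) → Fin (f i)

/-- The ancestor in generation `k` of a vertex of generation `n ≥ k`: its initial segment of
length `k`. In particular, the children of `u` in generation `n` are the `f n` vertices of
generation `n + 1` whose ancestor in generation `n` is `u`. -/
def ancestor {f : ℕ → ℕ} {n : ℕ} (v : Vertex f n) (k : ℕ) (hk : k ≤ n) : Vertex f k :=
  fun i => v (Fin.castLE hk i)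

/-- The edges of `T_f`. The edge `⟨n, v⟩` joins the vertex `v` of generation `n + 1` to its parent
`ancestor v n _` in generation `n`. -/
abbrev Edge (f : ℕ → ℕ) : Type := Σ n : ℕ, Vertex f (n + 1)

/-- The weight of the path from the root to a vertex `v` of generation `n`: the sum of the weights
of its `n` edges. -/
def pathWeight {f : ℕ → ℕ} (w : Edge f → ℝ≥0) {n : ℕ} (v : Vertex f n) : ℝ≥0 :=
  ∑ k : Fin n, w ⟨k, ancestor v (k + 1) k.isLt⟩

/-- `m_n`: the minimum weight of a path from the root to a vertex of generation `n`. -/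
def minWeight {f : ℕ → ℕ} (w : Edge f → ℝ≥0) (n : ℕ) : ℝ≥0∞ :=
  ⨅ v : Vertex f n, (pathWeight w v : ℝ≥0∞)

/-- The weighted tree is explosive: `lim m_n < ∞`. -/
def Explosive {f : ℕ → ℕ} (w : Edge f → ℝ≥0) : Prop :=
  ∃ L : ℝ≥0∞, L < ∞ ∧ Tendsto (minWeight w) atTop (𝓝 L)

/-- `f` is `G`-explosive: the tree `T_f` with i.i.d. edge weights of law `ν` (that is, with the
weights distributed according to the product measure) is explosive almost surely. -/
def GExplosive (ν : Measure ℝ≥0) [IsProbabilityMeasure ν] (f : ℕ → ℕ) : Prop :=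
  ∀ᵐ w ∂(Measure.infinitePi fun _ : Edge f => ν), Explosive w

end SphericalTree

end

/-! Write `q n` for the quantile at `1 / f n`, the typical size of the minimum of `f n` independent
weights. Control turns `G` into a function with power-like bounds near `0`, so expectations can be
compared with quantiles. If the series converges, extend a cheapest path of generation `n` by its
cheapest child edge. With weights truncated at `x₀` this costs `O(q n)` on average
(`exists_lintegral_min_le`), so the truncated minima stay bounded almost surely. König's lemma gives
one ray of finite truncated weight, along which truncation is eventually inactive. If it diverges,
let `g n` be `q n` capped at `x₀`. For large `B` the expected sum over generation `n` of `∏ exp (1 -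
B w / g i)` is at most `2⁻ⁿ` (`exists_lintegral_exp_le_half`). Almost surely, then, all long paths
satisfy `∑ (1 - B w / g i) ≤ 0`. As `g` is nonincreasing, summation by parts bounds `∑ g i` by a
constant plus `B` times the path weight, so path weights tend to infinity uniformly. -/

namespace SphericalTree

/-! ### Quantiles, Laplace transforms and minima under control near `0`. -/

section Distribution

variable {ν : Measure ℝ≥0}

theorem distrib_mono : Monotone (distrib ν) := fun _ _ h => measure_mono (Set.Iic_subset_Iic.2 h)

theorem distrib_le_one [IsProbabilityMeasure ν] (x : ℝ≥0) : distrib ν x ≤ 1 := prob_le_one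

theorem quantile_mono : Monotone (quantile ν) := fun _ _ h =>
  iInf_mono fun _ => iInf_mono' fun hq => ⟨h.trans hq, le_rfl⟩

theorem distrib_lt_of_lt_quantile {p : ℝ≥0∞} {x : ℝ≥0} (h : (x : ℝ≥0∞) < quantile ν p) :
    distrib ν x < p := by
  by_contra! hp
  exact h.not_ge (iInf₂_le x hp)

theorem le_distrib_of_quantile_lt {p : ℝ≥0∞} {x : ℝ≥0} (h : quantile ν p < x) :
    p ≤ distrib ν x := by
  simp only [quantile, iInf_lt_iff] at h
  obtain ⟨y, hy, hyx⟩ := h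
  exact hy.trans (distrib_mono (by exact_mod_cast hyx.le))

theorem le_quantile {p : ℝ≥0∞} {x : ℝ≥0} (h : distrib ν x < p) : (x : ℝ≥0∞) ≤ quantile ν p :=
  le_iInf₂ fun y hy => by
    by_contra! hyx
    exact (hy.trans (distrib_mono (by exact_mod_cast hyx.le))).not_gt h

/-- The ratio of consecutive terms is `b * exp (-(c - 1) c ^ j)`, which tends to `0`. -/
theorem tsum_pow_mul_exp_neg_pow_ne_top (b c : ℝ≥0) (hc : 1 < c) :
    ∑' j : ℕ, (b : ℝ≥0∞) ^ j * ENNReal.ofReal (Real.exp (-(c : ℝ) ^ j)) ≠ ∞ := by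
  have hc' : (1 : ℝ) < c := by exact_mod_cast hc
  rcases eq_or_ne b 0 with rfl | hb
  · rw [tsum_eq_single 0]
    · simp
    · intro j hj
      simp [hj]
  have hb' : (0 : ℝ) < b := by exact_mod_cast hb.bot_lt
  have hs : Summable fun j : ℕ => (b : ℝ) ^ j * Real.exp (-(c : ℝ) ^ j) := by
    refine summable_of_ratio_test_tendsto_lt_one (l := 0) one_pos
      (Eventually.of_forall fun j => by positivity) ?_
    have h1 : Tendsto (fun j : ℕ => (b : ℝ) * Real.exp (-((c - 1) * (c : ℝ) ^ j))) atTop (𝓝 0) := by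
      have := (Real.tendsto_exp_neg_atTop_nhds_zero.comp
        ((tendsto_pow_atTop_atTop_of_one_lt hc').const_mul_atTop (sub_pos.2 hc'))).const_mul (b : ℝ)
      simpa using this
    refine h1.congr fun j => ?_
    rw [Real.norm_of_nonneg (by positivity), Real.norm_of_nonneg (by positivity),
      eq_div_iff (by positivity), pow_succ,
      show -(c : ℝ) ^ (j + 1) = -((c - 1) * (c : ℝ) ^ j) + -(c : ℝ) ^ j by ring, Real.exp_add]
    ring
  have : ∀ j : ℕ, (b : ℝ≥0∞) ^ j * ENNReal.ofReal (Real.exp (-(c : ℝ) ^ j)) =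
      ENNReal.ofReal ((b : ℝ) ^ j * Real.exp (-(c : ℝ) ^ j)) := fun j => by
    rw [ENNReal.ofReal_mul (by positivity), ENNReal.ofReal_pow hb'.le, ENNReal.ofReal_coe_nnreal]
  simp_rw [this]
  exact hs.tsum_ofReal_ne_top

/-- Near `0`, multiplication of the argument by `c` multiplies the distribution function by a
factor between `a` and `b`. -/
structure ControlledBy (ν : Measure ℝ≥0) (a b c x₀ : ℝ≥0) : Prop where
  one_lt_a : 1 < a
  one_lt_c : 1 < c
  x₀_pos : 0 < x₀
  distrib_pos : ∀ x, 0 < x → x ≤ x₀ → 0 < distrib ν x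
  le_distrib_mul : ∀ x, 0 < x → x ≤ x₀ → a * distrib ν x ≤ distrib ν (c * x)
  distrib_mul_le : ∀ x, 0 < x → x ≤ x₀ → distrib ν (c * x) ≤ b * distrib ν x

theorem ControlledNearZero.exists_controlledBy [IsProbabilityMeasure ν]
    (h : ControlledNearZero ν) : ∃ a b c x₀, ControlledBy ν a b c x₀ := by
  obtain ⟨c, hc, hinf, hsup⟩ := h
  obtain ⟨a, ha1, ha⟩ := ENNReal.lt_iff_exists_nnreal_btwn.1 hinf
  obtain ⟨b, hb1, hb⟩ := ENNReal.lt_iff_exists_nnreal_btwn.1 hsup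
  have hev := (eventually_lt_of_lt_liminf ha).and (eventually_lt_of_limsup_lt hb1)
  obtain ⟨u, hu, hsub⟩ := (mem_nhdsGT_iff_exists_Ioc_subset (a := (0 : ℝ≥0))).1 hev
  have hfin : ∀ x, distrib ν x ≠ ∞ := fun x => measure_ne_top _ _
  have hpos : ∀ x, 0 < x → x ≤ u → 0 < distrib ν x := fun x h0 hx => by
    have h1 := hsub ⟨h0, hx⟩
    refine pos_iff_ne_zero.2 fun h2 => ?_
    simp only [Set.mem_ofPred_eq, h2] at h1
    -- If `G x = 0`, the quotient is `0` or `∞`; neither lies between `a` and `b`.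
    by_cases h3 : distrib ν (c * x) = 0
    · simp [h3] at h1
    · rw [ENNReal.div_zero h3] at h1
      exact not_top_lt h1.2
  refine ⟨a, b, c, u, by exact_mod_cast ha1, hc, hu, hpos, fun x h0 hx => ?_, fun x h0 hx => ?_⟩
  · exact ((ENNReal.le_div_iff_mul_le (.inl (hpos x h0 hx).ne') (.inl (hfin x))).1
      (hsub ⟨h0, hx⟩).1.le)
  · exact ((ENNReal.div_le_iff_le_mul (.inl (hpos x h0 hx).ne') (.inl (hfin x))).1
      (hsub ⟨h0, hx⟩).2.le)

namespace ControlledBy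

variable {a b c x₀ : ℝ≥0}

theorem c_pos (h : ControlledBy ν a b c x₀) : 0 < c := one_pos.trans h.one_lt_c

theorem pow_mul_distrib_le (h : ControlledBy ν a b c x₀) {x : ℝ≥0} (hx : 0 < x) (j : ℕ)
    (hj : ∀ i < j, c ^ i * x ≤ x₀) : (a : ℝ≥0∞) ^ j * distrib ν x ≤ distrib ν (c ^ j * x) := by
  induction j with
  | zero => simp
  | succ j ih =>
    have hc := h.c_pos
    calc (a : ℝ≥0∞) ^ (j + 1) * distrib ν x = a * (a ^ j * distrib ν x) := by ring
      _ ≤ a * distrib ν (c ^ j * x) := by gcongr; exact ih fun i hi => hj i (by omega)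
      _ ≤ distrib ν (c * (c ^ j * x)) := h.le_distrib_mul _ (by positivity) (hj j (by omega))
      _ = _ := by ring_nf

theorem pow_mul_le {c x₀ : ℝ≥0} (hc : 1 < c) {x : ℝ≥0} {j : ℕ} (hx : c ^ j * x ≤ x₀)
    (i : ℕ) (hi : i ≤ j) : c ^ i * x ≤ x₀ :=
  le_trans (by gcongr; exact hc.le) hx

theorem one_le_b [IsProbabilityMeasure ν] (h : ControlledBy ν a b c x₀) : 1 ≤ b := by
  have h1 := h.distrib_mul_le x₀ h.x₀_pos le_rfl
  by_contra! hb
  have h2 : (b : ℝ≥0∞) * distrib ν x₀ < 1 * distrib ν x₀ :=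
    (ENNReal.mul_lt_mul_iff_left (h.distrib_pos _ h.x₀_pos le_rfl).ne' (measure_ne_top _ _)).2
      (by exact_mod_cast hb)
  rw [one_mul] at h2
  exact (h1.trans_lt h2).not_ge (distrib_mono (le_mul_of_one_le_left' h.one_lt_c.le))

/-- Beyond `x₀` the growth bound is unavailable, but by then `b ^ j * G x` has reached `G x₀`, and
the prefactor lifts this to `1`. -/
theorem distrib_pow_mul_le [IsProbabilityMeasure ν] (h : ControlledBy ν a b c x₀) {x : ℝ≥0}
    (hx : 0 < x) (j : ℕ) :
    distrib ν (c ^ j * x) ≤ (distrib ν x₀)⁻¹ * (b ^ j * distrib ν x) := by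
  have hb : (1 : ℝ≥0∞) ≤ b := by exact_mod_cast h.one_le_b
  have key : distrib ν (c ^ j * x) ≤ b ^ j * distrib ν x ∨
      distrib ν x₀ ≤ b ^ j * distrib ν x := by
    induction j with
    | zero => simp
    | succ j ih =>
      have hle : (b : ℝ≥0∞) ^ j * distrib ν x ≤ b ^ (j + 1) * distrib ν x := by
        gcongr
        exact j.le_succ
      have hc := h.c_pos
      rcases ih with ih | ih
      · by_cases hj : c ^ j * x ≤ x₀
        · left
          calc distrib ν (c ^ (j + 1) * x) = distrib ν (c * (c ^ j * x)) := by ring_nf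
            _ ≤ b * distrib ν (c ^ j * x) := h.distrib_mul_le _ (by positivity) hj
            _ ≤ b * (b ^ j * distrib ν x) := by gcongr
            _ = _ := by ring
        · exact .inr ((distrib_mono (not_le.1 hj).le).trans (ih.trans hle))
      · exact .inr (ih.trans hle)
  have h0 := (h.distrib_pos _ h.x₀_pos le_rfl).ne'
  have ht : distrib ν x₀ ≠ ∞ := measure_ne_top _ _
  rcases key with key | key
  · refine key.trans (le_mul_of_one_le_left' ?_)
    exact ENNReal.one_le_inv.2 (distrib_le_one _)
  · calc _ ≤ 1 := distrib_le_one _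
      _ = (distrib ν x₀)⁻¹ * distrib ν x₀ := (ENNReal.inv_mul_cancel h0 ht).symm
      _ ≤ _ := by gcongr

/-- The Laplace transform of `ν` at `1 / y` is comparable with the distribution function at `y`. -/
theorem exists_lintegral_exp_neg_le [IsProbabilityMeasure ν] (h : ControlledBy ν a b c x₀) :
    ∃ K : ℝ≥0∞, K ≠ ∞ ∧ ∀ y : ℝ≥0, 0 < y →
      ∫⁻ z, ENNReal.ofReal (Real.exp (-((z : ℝ) / y))) ∂ν ≤ K * distrib ν y := by
  set S : ℝ≥0∞ := ∑' j : ℕ, (b : ℝ≥0∞) ^ j * ENNReal.ofReal (Real.exp (-(c : ℝ) ^ j)) with hS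
  have hSt : S ≠ ∞ := tsum_pow_mul_exp_neg_pow_ne_top b c h.one_lt_c
  refine ⟨1 + (distrib ν x₀)⁻¹ * b * S, ?_, fun y hy => ?_⟩
  · have := ENNReal.inv_ne_top.2 (h.distrib_pos _ h.x₀_pos le_rfl).ne'
    finiteness
  have hc : (1 : ℝ) < c := by exact_mod_cast h.one_lt_c
  have hy' : (0 : ℝ) < y := by exact_mod_cast hy
  -- On the layer `c ^ j * y ≤ z < c ^ (j + 1) * y` the integrand is at most `exp (-c ^ j)`.
  have hpt : ∀ z : ℝ≥0, ENNReal.ofReal (Real.exp (-((z : ℝ) / y))) ≤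
      (Set.Iic y).indicator 1 z + ∑' j : ℕ, ENNReal.ofReal (Real.exp (-(c : ℝ) ^ j)) *
        (Set.Iic (c ^ (j + 1) * y)).indicator 1 z := fun z => by
    rcases le_or_gt z y with hz | hz
    · refine le_add_right ?_
      rw [Set.indicator_of_mem (by exact hz)]
      simp only [Pi.one_apply, ENNReal.ofReal_le_one, Real.exp_le_one_iff, Left.neg_nonpos_iff]
      positivity
    · refine le_add_left ?_
      have hz' : (y : ℝ) ≤ z := by exact_mod_cast hz.le
      obtain ⟨j, hj1, hj2⟩ := exists_nat_pow_near ((one_le_div hy').2 hz') hc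
      refine le_trans ?_ (ENNReal.le_tsum j)
      rw [Set.indicator_of_mem]
      · simp only [Pi.one_apply, mul_one]
        gcongr
      · rw [div_lt_iff₀ hy'] at hj2
        exact le_of_lt (by exact_mod_cast hj2)
  have hm : ∀ y : ℝ≥0, Measurable ((Set.Iic y).indicator (1 : ℝ≥0 → ℝ≥0∞)) :=
    fun y => measurable_one.indicator measurableSet_Iic
  calc _ ≤ ∫⁻ z, ((Set.Iic y).indicator 1 z + ∑' j : ℕ, ENNReal.ofReal (Real.exp (-(c : ℝ) ^ j)) *
        (Set.Iic (c ^ (j + 1) * y)).indicator 1 z) ∂ν := lintegral_mono hpt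
    _ = distrib ν y + ∑' j : ℕ, ENNReal.ofReal (Real.exp (-(c : ℝ) ^ j)) *
        distrib ν (c ^ (j + 1) * y) := by
      rw [lintegral_add_left (hm _), lintegral_tsum fun j => ((hm _).const_mul _).aemeasurable,
        lintegral_indicator_one measurableSet_Iic]
      congr 2
      ext j
      rw [lintegral_const_mul _ (hm _), lintegral_indicator_one measurableSet_Iic]
      rfl
    _ ≤ distrib ν y + ∑' j : ℕ, ENNReal.ofReal (Real.exp (-(c : ℝ) ^ j)) *
        ((distrib ν x₀)⁻¹ * (b ^ (j + 1) * distrib ν y)) := by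
      gcongr with j
      exact h.distrib_pow_mul_le hy _
    _ = _ := by
      rw [hS, add_mul, one_mul, ← ENNReal.tsum_mul_left, ← ENNReal.tsum_mul_right]
      congr 2
      ext j
      ring

theorem exists_lintegral_exp_le_half [IsProbabilityMeasure ν] (h : ControlledBy ν a b c x₀) :
    ∃ B : ℝ≥0, ∀ (F : ℕ) (x : ℝ≥0), 0 < x → x ≤ x₀ →
      (x : ℝ≥0∞) ≤ quantile ν (F : ℝ≥0∞)⁻¹ →
      F * ∫⁻ z, ENNReal.ofReal (Real.exp (1 - B * z / x)) ∂ν ≤ 2⁻¹ := by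
  obtain ⟨K, hK, hlap⟩ := h.exists_lintegral_exp_neg_le
  have hc := h.c_pos
  have ha : (1 : ℝ≥0∞) < a := by exact_mod_cast h.one_lt_a
  set K' : ℝ≥0∞ := 2 * (ENNReal.ofReal (Real.exp 1) * K) with hK'
  obtain ⟨m, hm⟩ : ∃ m : ℕ, K' ≤ (a : ℝ≥0∞) ^ m :=
    (((ENNReal.tendsto_pow_atTop_nhds_top_iff).2 ha).eventually (eventually_ge_nhds
      (lt_top_iff_ne_top.2 (by finiteness)))).exists
  -- One factor `c` puts `x / c` strictly below the quantile, so `G (x / c) < 1 / F`; the other `m`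
  -- gain `a ^ m`, which absorbs `2 e K`.
  refine ⟨c ^ (m + 1), fun F x hx hx0 hF => ?_⟩
  set y : ℝ≥0 := x / c ^ (m + 1) with hy
  have hy0 : 0 < y := by positivity
  have hyx : c ^ m * y = x / c := by rw [hy, pow_succ]; field_simp
  have hxc : x / c < x := div_lt_self hx h.one_lt_c
  have hG : distrib ν (x / c) < (F : ℝ≥0∞)⁻¹ :=
    distrib_lt_of_lt_quantile (lt_of_lt_of_le (by exact_mod_cast hxc) hF)
  have hpow : (a : ℝ≥0∞) ^ m * distrib ν y ≤ distrib ν (x / c) := by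
    rw [← hyx]
    refine h.pow_mul_distrib_le hy0 m fun i hi => pow_mul_le h.one_lt_c (j := m) ?_ i hi.le
    rw [hyx]
    exact hxc.le.trans hx0
  have hint : ∫⁻ z, ENNReal.ofReal (Real.exp (1 - ((c ^ (m + 1) : ℝ≥0) : ℝ) * z / x)) ∂ν ≤
      ENNReal.ofReal (Real.exp 1) * (K * distrib ν y) := by
    refine le_trans (le_of_eq ?_) (mul_le_mul_right (hlap y hy0) (ENNReal.ofReal (Real.exp 1)))
    rw [← lintegral_const_mul _ (by fun_prop)]
    refine lintegral_congr fun z => ?_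
    rw [← ENNReal.ofReal_mul (by positivity), ← Real.exp_add]
    congr 2
    rw [hy]
    push_cast
    field_simp
    ring
  have h2 : 2 * (F * ∫⁻ z, ENNReal.ofReal (Real.exp (1 - ((c ^ (m + 1) : ℝ≥0) : ℝ) * z / x)) ∂ν)
      ≤ 1 := by
    calc _ ≤ 2 * (F * (ENNReal.ofReal (Real.exp 1) * (K * distrib ν y))) := by gcongr
      _ = F * (K' * distrib ν y) := by rw [hK']; ring
      _ ≤ F * (a ^ m * distrib ν y) := by gcongr
      _ ≤ F * (F : ℝ≥0∞)⁻¹ := by gcongr; exact hpow.trans hG.le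
      _ ≤ 1 := ENNReal.mul_inv_le_one _
  rwa [mul_comm, ← ENNReal.le_div_iff_mul_le (by simp) (by simp), one_div] at h2

/-- Since `a ^ m * G (x₀ / c ^ m) ≤ 1`, `G` tends to `0` at `0`. -/
theorem quantile_pos [IsProbabilityMeasure ν] (h : ControlledBy ν a b c x₀) {p : ℝ≥0∞}
    (hp : p ≠ 0) : 0 < quantile ν p := by
  have hc := h.c_pos
  have hx := h.x₀_pos
  have ha : (1 : ℝ≥0∞) < a := by exact_mod_cast h.one_lt_a
  obtain ⟨m, hm⟩ : ∃ m : ℕ, p⁻¹ < (a : ℝ≥0∞) ^ m :=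
    (((ENNReal.tendsto_pow_atTop_nhds_top_iff).2 ha).eventually (eventually_gt_nhds
      (ENNReal.inv_lt_top.2 (pos_iff_ne_zero.2 hp)))).exists
  set y : ℝ≥0 := x₀ / c ^ m with hy
  have hy0 : 0 < y := by positivity
  have hyx : c ^ m * y = x₀ := by rw [hy]; field_simp
  have h1 : (a : ℝ≥0∞) ^ m * distrib ν y ≤ 1 :=
    (h.pow_mul_distrib_le hy0 m fun i hi =>
      pow_mul_le h.one_lt_c (j := m) hyx.le i hi.le).trans (distrib_le_one _)
  have h2 : distrib ν y < p := by
    have h3 : distrib ν y ≤ ((a : ℝ≥0∞) ^ m)⁻¹ := by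
      rw [mul_comm] at h1
      exact ENNReal.le_inv_iff_mul_le.2 h1
    exact h3.trans_lt (ENNReal.inv_lt_iff_inv_lt.1 hm)
  exact lt_of_lt_of_le (by exact_mod_cast hy0) (le_quantile h2)

/-- If `M` has a tail at most that of the minimum of `F` independent weights, then the truncation
of `M` has expectation of order at most the `1 / F`-quantile. -/
theorem exists_lintegral_min_le [IsProbabilityMeasure ν] (h : ControlledBy ν a b c x₀) :
    ∃ K : ℝ≥0∞, K ≠ ∞ ∧ ∀ {Ω : Type} [MeasurableSpace Ω] (μ : Measure Ω) [IsProbabilityMeasure μ]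
      (F : ℕ) (M : Ω → ℝ≥0∞), 0 < F → Measurable M →
      (∀ s : ℝ≥0, μ {ω | (s : ℝ≥0∞) < M ω} ≤ ν (Set.Ioi s) ^ F) →
      ∫⁻ ω, min (x₀ : ℝ≥0∞) (M ω) ∂μ ≤ K * quantile ν (F : ℝ≥0∞)⁻¹ := by
  set S : ℝ≥0∞ := ∑' j : ℕ, (c : ℝ≥0∞) ^ j * ENNReal.ofReal (Real.exp (-(a : ℝ) ^ j)) with hS
  have hSt : S ≠ ∞ := tsum_pow_mul_exp_neg_pow_ne_top c a h.one_lt_a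
  have hc := h.c_pos
  refine ⟨c ^ 2 + c ^ 3 * S, by finiteness, fun {Ω} _ μ _ F M hF hM htail => ?_⟩
  have hF0 : (F : ℝ≥0∞)⁻¹ ≠ 0 := by simp
  have hqpos := h.quantile_pos hF0
  have hFr : (0 : ℝ) < F := by exact_mod_cast hF
  rcases eq_or_ne (quantile ν (F : ℝ≥0∞)⁻¹) ∞ with hq | hq
  · rw [hq, ENNReal.mul_top (by positivity)]
    exact le_top
  lift quantile ν (F : ℝ≥0∞)⁻¹ to ℝ≥0 using hq with t ht
  have ht0 : 0 < t := by exact_mod_cast hqpos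
  have hGt : (F : ℝ≥0∞)⁻¹ ≤ distrib ν (c * t) := le_distrib_of_quantile_lt (by
    rw [← ht]
    exact_mod_cast lt_mul_of_one_lt_left ht0 h.one_lt_c)
  -- The tail is at most `(1 - a ^ j / F) ^ F ≤ exp (-a ^ j)`.
  have hprob : ∀ j : ℕ, c ^ (j + 1) * t ≤ x₀ → μ {ω | ((c ^ (j + 1) * t : ℝ≥0) : ℝ≥0∞) < M ω} ≤
      ENNReal.ofReal (Real.exp (-(a : ℝ) ^ j)) := fun j hj => by
    refine (htail _).trans ?_
    have h1 : (a : ℝ≥0∞) ^ j * (F : ℝ≥0∞)⁻¹ ≤ distrib ν (c ^ (j + 1) * t) := by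
      have := h.pow_mul_distrib_le (x := c * t) (by positivity) j fun i hi =>
        pow_mul_le h.one_lt_c (j := j) (by rw [← mul_assoc, ← pow_succ]; exact hj) i hi.le
      rw [← mul_assoc, ← pow_succ] at this
      exact le_trans (by gcongr) this
    have h2 : ν (Set.Ioi (c ^ (j + 1) * t)) = 1 - distrib ν (c ^ (j + 1) * t) := by
      rw [← Set.compl_Iic, prob_compl_eq_one_sub measurableSet_Iic]
      rfl
    have h3 : (a : ℝ≥0∞) ^ j * (F : ℝ≥0∞)⁻¹ = ENNReal.ofReal ((a : ℝ) ^ j / F) := by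
      rw [ENNReal.ofReal_div_of_pos hFr, ENNReal.ofReal_pow (by positivity),
        ENNReal.ofReal_coe_nnreal, ENNReal.ofReal_natCast, div_eq_mul_inv]
    have h4 : ν (Set.Ioi (c ^ (j + 1) * t)) ≤
        ENNReal.ofReal (Real.exp (-((a : ℝ) ^ j / F))) := by
      rw [h2]
      refine (tsub_le_tsub_left h1 1).trans ?_
      rw [h3, ← ENNReal.ofReal_one, ← ENNReal.ofReal_sub _ (by positivity)]
      exact ENNReal.ofReal_le_ofReal (Real.one_sub_le_exp_neg _)
    calc _ ≤ ENNReal.ofReal (Real.exp (-((a : ℝ) ^ j / F))) ^ F := by gcongr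
      _ = _ := by
        rw [← ENNReal.ofReal_pow (by positivity), ← Real.exp_nat_mul]
        congr 2
        field_simp
  have hset : ∀ j : ℕ, MeasurableSet {ω | ((c ^ (j + 1) * t : ℝ≥0) : ℝ≥0∞) < M ω} :=
    fun j => measurableSet_lt measurable_const hM
  -- Layers run from `c ^ (j + 2) * t` to `c ^ (j + 3) * t`; the spare factor `c` makes `c ^ (j + 1)
  -- * t < M` strict, and the truncation keeps this threshold below `x₀`, where `hprob` applies.
  have hpt : ∀ ω, min (x₀ : ℝ≥0∞) (M ω) ≤ ((c ^ 2 * t : ℝ≥0) : ℝ≥0∞) +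
      ∑' j : ℕ, (if c ^ (j + 1) * t ≤ x₀ then ((c ^ (j + 3) * t : ℝ≥0) : ℝ≥0∞) else 0) *
        {ω | ((c ^ (j + 1) * t : ℝ≥0) : ℝ≥0∞) < M ω}.indicator 1 ω := fun ω => by
    have hfin : min (x₀ : ℝ≥0∞) (M ω) ≠ ∞ := ne_top_of_le_ne_top ENNReal.coe_ne_top (min_le_left _ _)
    have hzx := min_le_left (x₀ : ℝ≥0∞) (M ω)
    have hzM := min_le_right (x₀ : ℝ≥0∞) (M ω)
    lift min (x₀ : ℝ≥0∞) (M ω) to ℝ≥0 using hfin with z hz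
    have hzx' : z ≤ x₀ := by exact_mod_cast hzx
    rcases le_or_gt z (c ^ 2 * t) with hle | hgt
    · exact le_add_right (by exact_mod_cast hle)
    · refine le_add_left ?_
      have hpos : 0 < c ^ 2 * t := by positivity
      obtain ⟨j, hj1, hj2⟩ := exists_nat_pow_near ((one_le_div hpos).2 hgt.le) h.one_lt_c
      rw [le_div_iff₀ hpos, ← mul_assoc, ← pow_add] at hj1
      rw [div_lt_iff₀ hpos, ← mul_assoc, ← pow_add] at hj2
      have hj3 : c ^ (j + 1) * t < z := lt_of_lt_of_le (by
        gcongr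
        · exact h.one_lt_c
        · omega) hj1
      refine le_trans ?_ (ENNReal.le_tsum j)
      rw [Set.indicator_of_mem, if_pos (hj3.le.trans hzx')]
      · simp only [Pi.one_apply, mul_one]
        exact_mod_cast hj2.le
      · exact lt_of_lt_of_le (by exact_mod_cast hj3) hzM
  calc _ ≤ _ := lintegral_mono hpt
    _ = ((c ^ 2 * t : ℝ≥0) : ℝ≥0∞) +
      ∑' j : ℕ, (if c ^ (j + 1) * t ≤ x₀ then ((c ^ (j + 3) * t : ℝ≥0) : ℝ≥0∞) else 0) *
        μ {ω | ((c ^ (j + 1) * t : ℝ≥0) : ℝ≥0∞) < M ω} := by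
      have hm := fun j => (measurable_one (α := ℝ≥0∞)).indicator (hset j)
      rw [lintegral_add_left measurable_const, lintegral_const, measure_univ, mul_one,
        lintegral_tsum fun j => ((hm j).const_mul _).aemeasurable]
      congr 2
      ext j
      rw [lintegral_const_mul _ (hm j), lintegral_indicator_one (hset j)]
    _ ≤ ((c ^ 2 * t : ℝ≥0) : ℝ≥0∞) +
      ∑' j : ℕ, ((c ^ (j + 3) * t : ℝ≥0) : ℝ≥0∞) * ENNReal.ofReal (Real.exp (-(a : ℝ) ^ j)) := by
      refine add_le_add_right (ENNReal.tsum_le_tsum fun j => ?_) _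
      split_ifs with hj
      · gcongr
        exact hprob j hj
      · simp
    _ = _ := by
      rw [hS, add_mul, ← ENNReal.tsum_mul_left, ← ENNReal.tsum_mul_right]
      push_cast
      congr 2
      ext j
      ring

end ControlledBy

end Distribution

/-! ### Paths and the many-to-one formula. -/

variable {f : ℕ → ℕ}

/-- The last edge of the initial segment of length `i + 1` of the path to `v`. -/
abbrev pathEdge {n : ℕ} (v : Vertex f n) (i : Fin n) : Edge f := ⟨i, ancestor v (i + 1) i.isLt⟩

theorem pathEdge_injective {n : ℕ} (v : Vertex f n) : Function.Injective (pathEdge v) :=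
  fun _ _ h => Fin.ext (congrArg Sigma.fst h)

/-- The law of i.i.d. edge weights. -/
noncomputable abbrev weightLaw (ν : Measure ℝ≥0) [IsProbabilityMeasure ν] (f : ℕ → ℕ) :
    Measure (Edge f → ℝ≥0) := Measure.infinitePi fun _ : Edge f => ν

section Independence

variable (ν : Measure ℝ≥0) [IsProbabilityMeasure ν]

theorem lintegral_eval_weightLaw (e : Edge f) {φ : ℝ≥0 → ℝ≥0∞} (hφ : Measurable φ) :
    ∫⁻ w, φ (w e) ∂weightLaw ν f = ∫⁻ x, φ x ∂ν :=
  (measurePreserving_eval_infinitePi (fun _ : Edge f => ν) e).lintegral_comp hφ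

/-- The many-to-one formula for products along paths. -/
theorem lintegral_sum_prod_pathEdge {φ : ℕ → ℝ≥0 → ℝ≥0∞} (hφ : ∀ i, Measurable (φ i)) (n : ℕ) :
    ∫⁻ w, ∑ v : Vertex f n, ∏ i : Fin n, φ i (w (pathEdge v i)) ∂weightLaw ν f =
      ∏ i : Fin n, (f i * ∫⁻ x, φ i x ∂ν) := by
  have hm : ∀ (v : Vertex f n) (i : Fin n),
      Measurable fun w : Edge f → ℝ≥0 => φ i (w (pathEdge v i)) := fun v i =>
    (hφ i).comp (measurable_pi_apply _)
  rw [lintegral_finsetSum _ fun v _ => Finset.measurable_prod _ fun i _ => hm v i]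
  have hv : ∀ v : Vertex f n,
      ∫⁻ w, ∏ i : Fin n, φ i (w (pathEdge v i)) ∂weightLaw ν f = ∏ i : Fin n, ∫⁻ x, φ i x ∂ν :=
    fun v => by
    have hind : ProbabilityTheory.iIndepFun
        (fun (i : Fin n) (w : Edge f → ℝ≥0) => φ i (w (pathEdge v i))) (weightLaw ν f) :=
      (ProbabilityTheory.iIndepFun_infinitePi (P := fun _ : Edge f => ν)
        (X := fun e x => φ e.1 x) fun e => hφ e.1).precomp (pathEdge_injective v)
    rw [ProbabilityTheory.lintegral_prod_eq_prod_lintegral_of_indepFun _ _ hind (hm v)]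
    exact Finset.prod_congr rfl fun i _ => lintegral_eval_weightLaw ν _ (hφ i)
  simp_rw [hv]
  rw [Finset.sum_const, Finset.prod_mul_distrib, nsmul_eq_mul, Finset.card_univ, Fintype.card_pi]
  simp

end Independence

/-! ### Divergent series: the exponential first-moment bound. -/

/-- Summation by parts: weights that are nonincreasing preserve an upper bound on partial sums. -/
theorem sum_range_mul_le_of_antitone {g d : ℕ → ℝ} (hg : Antitone g) (hg0 : ∀ i, 0 ≤ g i) {C : ℝ}
    (n : ℕ) (hd : ∀ k ≤ n, ∑ i ∈ Finset.range k, d i ≤ C) :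
    ∑ i ∈ Finset.range n, g i * d i ≤ C * g 0 := by
  -- Keeping the nonpositive boundary term makes the induction close.
  have key : ∀ k ≤ n, ∑ i ∈ Finset.range k, g i * d i ≤
      C * g 0 + g k * (∑ i ∈ Finset.range k, d i - C) := fun k => by
    induction k with
    | zero => intro _; simp; linarith
    | succ k ih =>
      intro hk
      rw [Finset.sum_range_succ]
      have h1 := ih (by omega)
      have h2 := hd (k + 1) hk
      have h3 := mul_le_mul_of_nonpos_right (hg k.le_succ) (sub_nonpos.2 h2)
      rw [Finset.sum_range_succ] at h3 ⊢
      nlinarith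
  have h1 := key n le_rfl
  have h2 := mul_nonpos_of_nonneg_of_nonpos (hg0 n) (sub_nonpos.2 (hd n le_rfl))
  linarith

/-- Partial sums of `1 - B X i / g i` are nonpositive from `N` on and at most `N` before; weighting
by `g i` turns the summands into `g i - B X i`. -/
theorem sum_range_le_of_prod_exp_le_one {g : ℕ → ℝ≥0} (hg : Antitone g) (hg0 : ∀ i, 0 < g i)
    {B : ℝ≥0} {N n : ℕ} {w : Edge f → ℝ≥0} {v : Vertex f n}
    (hN : ∀ k (hk : k ≤ n), N ≤ k → ∏ i : Fin k,
      ENNReal.ofReal (Real.exp (1 - B * w (pathEdge (ancestor v k hk) i) / g i)) ≤ 1) :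
    ∑ i ∈ Finset.range n, g i ≤ N * g 0 + B * pathWeight w v := by
  set X : ℕ → ℝ≥0 := fun i => if h : i < n then w (pathEdge v ⟨i, h⟩) else 0 with hX
  have hXv : ∀ k (hk : k ≤ n) (i : Fin k), w (pathEdge (ancestor v k hk) i) = X i :=
    fun k hk i => by
      rw [hX]
      simp only [i.isLt.trans_le hk, dif_pos]
      rfl
  have hw : pathWeight w v = ∑ i ∈ Finset.range n, X i := by
    rw [Finset.sum_range]
    exact Finset.sum_congr rfl fun i _ => hXv n le_rfl i
  have hle1 : ∀ i, (1 : ℝ) - B * X i / g i ≤ 1 := fun i => by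
    have : (0 : ℝ) ≤ B * X i / g i := by positivity
    linarith
  have hd : ∀ k ≤ n, ∑ i ∈ Finset.range k, ((1 : ℝ) - B * X i / g i) ≤ N := fun k hk => by
    rcases le_or_gt N k with hNk | hNk
    · refine le_trans ?_ N.cast_nonneg
      have h1 := hN k hk hNk
      rw [← ENNReal.ofReal_prod_of_nonneg fun i _ => by positivity, ← Real.exp_sum,
        ENNReal.ofReal_le_one, Real.exp_le_one_iff] at h1
      rw [Finset.sum_range]
      simpa only [hXv] using h1
    · calc _ ≤ ∑ i ∈ Finset.range k, (1 : ℝ) := Finset.sum_le_sum fun i _ => hle1 i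
        _ = k := by simp
        _ ≤ N := by exact_mod_cast hNk.le
  have h1 := sum_range_mul_le_of_antitone (g := fun i => (g i : ℝ)) (fun i j hij => hg hij)
    (fun i => (g i).2) n hd
  have h2 : ∀ i, (g i : ℝ) * (1 - B * X i / g i) = g i - B * X i := fun i => by
    have : (0 : ℝ) < g i := hg0 i
    field_simp
  simp_rw [h2, Finset.sum_sub_distrib, ← Finset.mul_sum] at h1
  rw [hw, ← NNReal.coe_le_coe]
  push_cast
  linarith

/-- Terms of a convergent series are eventually at most `1`, hence so is each vertex's product.
Paths of bounded weight to every generation would then bound the partial sums of `g`. -/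
theorem not_explosive_of_tsum_prod_exp_ne_top {g : ℕ → ℝ≥0} (hg : Antitone g)
    (hg0 : ∀ i, 0 < g i) (hgs : ¬ Summable g) {B : ℝ≥0} {w : Edge f → ℝ≥0}
    (hw : ∑' n, ∑ v : Vertex f n, ∏ i : Fin n,
      ENNReal.ofReal (Real.exp (1 - B * w (pathEdge v i) / g i)) ≠ ∞) : ¬ Explosive w := by
  rintro ⟨L, hL, hlim⟩
  obtain ⟨N, hN⟩ := eventually_atTop.1 ((ENNReal.tendsto_atTop_zero_of_tsum_ne_top hw).eventually
    (eventually_le_nhds one_pos))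
  lift L to ℝ≥0 using hL.ne
  have hev := hlim.eventually (eventually_lt_nhds (b := ((L + 1 : ℝ≥0) : ℝ≥0∞))
    (by exact_mod_cast lt_add_one L))
  have hinf := (NNReal.not_summable_iff_tendsto_nat_atTop.1 hgs).eventually
    (eventually_gt_atTop (N * g 0 + B * (L + 1)))
  obtain ⟨n, hn1, hn2⟩ := (hev.and hinf).exists
  obtain ⟨v, hv⟩ := iInf_lt_iff.1 hn1
  have hv' : pathWeight w v ≤ L + 1 := by exact_mod_cast hv.le
  have h1 := sum_range_le_of_prod_exp_le_one (B := B) (N := N) (w := w) (v := v) hg hg0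
    fun k hk hNk => (Finset.single_le_sum (f := fun u : Vertex f k => ∏ i : Fin k,
      ENNReal.ofReal (Real.exp (1 - B * w (pathEdge u i) / g i))) (fun _ _ => zero_le)
      (Finset.mem_univ (ancestor v k hk))).trans (hN k hNk)
  refine hn2.not_ge (h1.trans ?_)
  gcongr

theorem ae_not_explosive {ν : Measure ℝ≥0} [IsProbabilityMeasure ν] {g : ℕ → ℝ≥0}
    (hg : Antitone g) (hg0 : ∀ i, 0 < g i) (hgs : ¬ Summable g) {B : ℝ≥0}
    (hB : ∀ i, f i * ∫⁻ z, ENNReal.ofReal (Real.exp (1 - B * z / g i)) ∂ν ≤ 2⁻¹) :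
    ∀ᵐ w ∂weightLaw ν f, ¬ Explosive w := by
  have hm : ∀ i, Measurable fun z : ℝ≥0 => ENNReal.ofReal (Real.exp (1 - B * z / g i)) :=
    fun i => by fun_prop
  have hM : ∀ n, Measurable fun w : Edge f → ℝ≥0 => ∑ v : Vertex f n, ∏ i : Fin n,
      ENNReal.ofReal (Real.exp (1 - B * w (pathEdge v i) / g i)) := fun n =>
    Finset.measurable_sum _ fun v _ => Finset.measurable_prod _ fun i _ =>
      (hm i).comp (measurable_pi_apply _)
  have hint : ∫⁻ w, ∑' n, ∑ v : Vertex f n, ∏ i : Fin n,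
      ENNReal.ofReal (Real.exp (1 - B * w (pathEdge v i) / g i)) ∂weightLaw ν f ≠ ∞ := by
    rw [lintegral_tsum fun n => (hM n).aemeasurable]
    refine ne_top_of_le_ne_top (b := ∑' n : ℕ, (2⁻¹ : ℝ≥0∞) ^ n) ?_
      (ENNReal.tsum_le_tsum fun n => ?_)
    · rw [ENNReal.tsum_geometric, ENNReal.one_sub_inv_two]
      simp
    · rw [lintegral_sum_prod_pathEdge ν (φ := fun i z =>
        ENNReal.ofReal (Real.exp (1 - B * z / g i))) hm n]
      calc _ ≤ ∏ _i : Fin n, (2⁻¹ : ℝ≥0∞) := Finset.prod_le_prod' fun i _ => hB i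
        _ = _ := by simp
  filter_upwards [ae_lt_top (Measurable.tsum hM) hint] with w hw
  exact not_explosive_of_tsum_prod_exp_ne_top hg hg0 hgs hw.ne

theorem not_gExplosive_of_not_gSmall {ν : Measure ℝ≥0} [IsProbabilityMeasure ν]
    (hν : ControlledNearZero ν) (hf_mono : Monotone f) (hs : ¬ GSmall ν f) :
    ¬ GExplosive ν f := by
  obtain ⟨a, b, c, x₀, h⟩ := hν.exists_controlledBy
  obtain ⟨B, hB⟩ := h.exists_lintegral_exp_le_half
  set q : ℕ → ℝ≥0∞ := fun n => quantile ν (f n : ℝ≥0∞)⁻¹ with hq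
  -- Monotonicity of `f` enters only here, for the summation by parts.
  have hqanti : Antitone q := fun i j hij => quantile_mono
    (ENNReal.inv_le_inv.2 (by exact_mod_cast hf_mono hij))
  have hqpos : ∀ i, 0 < q i := fun i => h.quantile_pos (by simp)
  have hfin : ∀ i, min (q i) x₀ ≠ ∞ := fun i =>
    ne_top_of_le_ne_top ENNReal.coe_ne_top (min_le_right _ _)
  set g : ℕ → ℝ≥0 := fun i => (min (q i) x₀).toNNReal with hg
  have hgc : ∀ i, (g i : ℝ≥0∞) = min (q i) x₀ := fun i => ENNReal.coe_toNNReal (hfin i)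
  have hx₀ := h.x₀_pos
  have hganti : Antitone g := fun i j hij =>
    ENNReal.toNNReal_mono (hfin i) (min_le_min_right _ (hqanti hij))
  have hgpos : ∀ i, 0 < g i := fun i => by
    rw [← ENNReal.coe_pos, hgc]
    exact lt_min (hqpos i) (by exact_mod_cast hx₀)
  -- A summable `g` is eventually below `x₀`, so it agrees with `q` on a tail.
  have hgs : ¬ Summable g := fun hsum => hs <| by
    have hev := (NNReal.tendsto_atTop_zero_of_summable hsum).eventually (eventually_lt_nhds hx₀)
    obtain ⟨N, hN⟩ := eventually_atTop.1 hev
    refine ⟨N, ?_⟩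
    have heq : ∀ n, q (n + N) = g (n + N) := fun n => by
      have h1 : (g (n + N) : ℝ≥0∞) < x₀ := by exact_mod_cast hN (n + N) (by omega)
      rw [hgc] at h1 ⊢
      rcases min_lt_iff.1 h1 with h2 | h2
      · exact (min_eq_left h2.le).symm
      · exact absurd h2 (lt_irrefl _)
    change ∑' n, q (n + N) < ∞
    simp_rw [heq]
    exact lt_top_iff_ne_top.2 (ENNReal.tsum_coe_ne_top_iff_summable.2
      ((NNReal.summable_nat_add_iff N).2 hsum))
  have hae : ∀ᵐ w ∂weightLaw ν f, ¬ Explosive w := ae_not_explosive hganti hgpos hgs fun i =>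
    hB (f i) (g i) (hgpos i)
      (by rw [← ENNReal.coe_le_coe, hgc]; exact min_le_right _ _)
      (by rw [hgc]; exact min_le_left _ _)
  intro hexp
  obtain ⟨w, hw1, hw2⟩ := (hae.and hexp).exists
  exact hw1 hw2

/-! ### Independence of successive generations. -/

section Resampling

/-- The weights `w` below generation `n`, continued by the weights `w'`. -/
def splice (n : ℕ) (w w' : Edge f → ℝ≥0) : Edge f → ℝ≥0 := fun e => if e.1 < n then w e else w' e

/-- This replaces conditioning on the first `n` generations: the later weights become a separate
variable for Fubini. On cylinders the product over edges splits by generation. -/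
theorem measurePreserving_splice (ν : Measure ℝ≥0) [IsProbabilityMeasure ν] (n : ℕ) :
    MeasurePreserving (fun p : (Edge f → ℝ≥0) × (Edge f → ℝ≥0) => splice n p.1 p.2)
      ((weightLaw ν f).prod (weightLaw ν f)) (weightLaw ν f) := by
  have hm : Measurable fun p : (Edge f → ℝ≥0) × (Edge f → ℝ≥0) => splice n p.1 p.2 :=
    measurable_pi_lambda _ fun e => by
      unfold splice
      by_cases he : e.1 < n
      · simp only [he, if_true]; fun_prop
      · simp only [he, if_false]; fun_prop
  refine ⟨hm, Measure.eq_infinitePi _ fun s t ht => ?_⟩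
  have hpre : (fun p : (Edge f → ℝ≥0) × (Edge f → ℝ≥0) => splice n p.1 p.2) ⁻¹'
      Set.pi (s : Set (Edge f)) t =
      (Set.pi (s.filter fun e => e.1 < n : Finset (Edge f)) t) ×ˢ
        (Set.pi (s.filter fun e => ¬ e.1 < n : Finset (Edge f)) t) := by
    ext ⟨w, w'⟩
    simp only [Set.mem_preimage, Set.mem_pi, Finset.mem_coe, Set.mem_prod, Finset.mem_filter,
      splice]
    constructor
    · intro h
      exact ⟨fun e he => by simpa [he.2] using h e he.1, fun e he => by simpa [he.2] using h e he.1⟩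
    · rintro ⟨h1, h2⟩ e he
      split_ifs with hlt
      · exact h1 e ⟨he, hlt⟩
      · exact h2 e ⟨he, hlt⟩
  rw [Measure.map_apply hm (.pi s.countable_toSet fun _ _ => ht _), hpre, Measure.prod_prod,
    Measure.infinitePi_pi _ fun e _ => ht e, Measure.infinitePi_pi _ fun e _ => ht e,
    Finset.prod_filter_mul_prod_filter_not]

end Resampling

/-! ### Children and monotonicity of minimal weights. -/

section Children

/-- The `i`-th child of a vertex. -/
def child {n : ℕ} (v : Vertex f n) (i : Fin (f n)) : Vertex f (n + 1) :=
  Fin.snoc (α := fun j : Fin (n + 1) => Fin (f j)) v i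

theorem child_injective {n : ℕ} (v : Vertex f n) : Function.Injective (child v) :=
  fun _ _ h => by
    have := congrFun h (Fin.last n)
    simpa [child] using this

theorem ancestor_child {n : ℕ} (v : Vertex f n) (i : Fin (f n)) :
    ancestor (child v i) n n.le_succ = v :=
  funext fun j => Fin.snoc_castSucc (α := fun j : Fin (n + 1) => Fin (f j)) i v j

theorem pathWeight_succ (w : Edge f → ℝ≥0) {n : ℕ} (v : Vertex f (n + 1)) :
    pathWeight w v = pathWeight w (ancestor v n n.le_succ) + w ⟨n, v⟩ :=
  Fin.sum_univ_castSucc _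

theorem pathWeight_child (w : Edge f → ℝ≥0) {n : ℕ} (v : Vertex f n) (i : Fin (f n)) :
    pathWeight w (child v i) = pathWeight w v + w ⟨n, child v i⟩ := by
  rw [pathWeight_succ, ancestor_child]

theorem pathWeight_congr {w w' : Edge f → ℝ≥0} {n : ℕ} (h : ∀ e : Edge f, e.1 < n → w e = w' e)
    (v : Vertex f n) : pathWeight w v = pathWeight w' v :=
  Finset.sum_congr rfl fun i _ => h _ i.isLt

theorem minWeight_mono (w : Edge f → ℝ≥0) : Monotone (minWeight w) :=
  monotone_nat_of_le_succ fun n => le_iInf fun v =>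
    (iInf_le _ (ancestor v n n.le_succ)).trans (by
      rw [pathWeight_succ]
      exact_mod_cast le_self_add)

theorem minWeight_le_mul {w : Edge f → ℝ≥0} (hf_pos : ∀ n, 0 < f n) {x : ℝ≥0}
    (hw : ∀ e, w e ≤ x) (n : ℕ) : minWeight w n ≤ n * x := by
  have v : Vertex f n := fun i => ⟨0, hf_pos i⟩
  refine (iInf_le _ v).trans ?_
  have : pathWeight w v ≤ n * x := (Finset.sum_le_sum fun i _ => hw _).trans (by simp)
  exact_mod_cast this

theorem measurable_minWeight (n : ℕ) : Measurable fun w : Edge f → ℝ≥0 => minWeight w n :=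
  .iInf fun _ => .coe_nnreal_ennreal (Finset.measurable_sum _ fun _ _ => measurable_pi_apply _)

end Children

/-! ### From bounded minima to a single ray. -/

section Compactness

/-- König's lemma: bounded minimal weights are realized by one infinite path. -/
theorem exists_ray_pathWeight_le (hf_pos : ∀ n, 0 < f n) {w : Edge f → ℝ≥0} {L : ℝ≥0}
    (h : ∀ n, minWeight w n ≤ L) :
    ∃ ξ : (i : ℕ) → Fin (f i), ∀ n, pathWeight w (fun i : Fin n => ξ i : Vertex f n) ≤ L := by
  -- These are nested, nonempty closed subsets of the compact space of rays.
  let t : ℕ → Set ((i : ℕ) → Fin (f i)) := fun n =>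
    {ξ | pathWeight w (fun i : Fin n => ξ i : Vertex f n) ≤ L}
  have hcl : ∀ n, IsClosed (t n) := fun n => by
    have hc : Continuous fun ξ : (i : ℕ) → Fin (f i) => (fun i : Fin n => ξ i : Vertex f n) :=
      continuous_pi fun i => continuous_apply _
    exact (Set.toFinite {v : Vertex f n | pathWeight w v ≤ L}).isClosed.preimage hc
  have hne : (⋂ n, t n).Nonempty := by
    refine IsCompact.nonempty_iInter_of_sequence_nonempty_isCompact_isClosed t (fun n ξ hξ => ?_)
      (fun n => ?_) (hcl 0).isCompact hcl
    · refine le_trans ?_ (show pathWeight w (fun i : Fin (n + 1) => ξ i : Vertex f (n + 1)) ≤ L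
        from hξ)
      rw [pathWeight_succ]
      exact le_self_add
    · have : Nonempty (Vertex f n) := ⟨fun i => ⟨0, hf_pos i⟩⟩
      obtain ⟨v, hv⟩ := exists_eq_ciInf_of_finite
        (f := fun v : Vertex f n => (pathWeight w v : ℝ≥0∞))
      refine ⟨fun i => if hi : i < n then v ⟨i, hi⟩ else ⟨0, hf_pos i⟩, ?_⟩
      have hvL : pathWeight w v ≤ L := by
        have := hv.le.trans (h n)
        exact_mod_cast this
      have hEq : (fun i : Fin n => if hi : (i : ℕ) < n then v ⟨i, hi⟩ else ⟨0, hf_pos i⟩ :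
          Vertex f n) = v := funext fun i => by simp
      change pathWeight w (fun i : Fin n => if hi : (i : ℕ) < n then v ⟨i, hi⟩ else
        ⟨0, hf_pos i⟩ : Vertex f n) ≤ L
      rwa [hEq]
  obtain ⟨ξ, hξ⟩ := hne
  exact ⟨ξ, fun n => Set.mem_iInter.1 hξ n⟩

/-- Along one fixed ray, a finite truncated sum forces all but finitely many weights below `x₀`, so
the true sum is finite too. Minimizers varying with `n` would not allow this. -/
theorem explosive_of_minWeight_min_le (hf_pos : ∀ n, 0 < f n) {w : Edge f → ℝ≥0} {x₀ L : ℝ≥0}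
    (hx₀ : 0 < x₀) (h : ∀ n, minWeight (fun e => min x₀ (w e)) n ≤ L) : Explosive w := by
  obtain ⟨ξ, hξ⟩ := exists_ray_pathWeight_le hf_pos h
  set X : ℕ → ℝ≥0 := fun k => w ⟨k, fun i => ξ i⟩ with hX
  have hpath : ∀ n, pathWeight w (fun i : Fin n => ξ i : Vertex f n) =
      ∑ k ∈ Finset.range n, X k := fun n => by
    rw [Finset.sum_range]
    rfl
  have htr : Summable fun k => min x₀ (X k) := by
    refine NNReal.summable_of_sum_range_le (c := L) fun n => ?_
    rw [Finset.sum_range]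
    exact hξ n
  have hsum : Summable X := by
    obtain ⟨N, hN⟩ := eventually_atTop.1
      ((NNReal.tendsto_atTop_zero_of_summable htr).eventually (eventually_lt_nhds hx₀))
    rw [← NNReal.summable_nat_add_iff N] at htr ⊢
    refine htr.congr fun k => min_eq_right ?_
    rcases min_lt_iff.1 (hN (k + N) (by omega)) with h1 | h1
    · exact absurd h1 (lt_irrefl _)
    · exact h1.le
  refine ⟨⨆ n, minWeight w n, ?_, tendsto_atTop_iSup (minWeight_mono w)⟩
  refine lt_of_le_of_lt (iSup_le fun n => ?_) (ENNReal.coe_lt_top (r := ∑' k, X k))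
  refine (iInf_le _ (fun i : Fin n => ξ i : Vertex f n)).trans ?_
  rw [hpath]
  exact_mod_cast hsum.sum_le_tsum _ fun _ _ => zero_le

end Compactness

/-! ### Convergent series: the greedy path. -/

section Greedy

variable {ν : Measure ℝ≥0} [IsProbabilityMeasure ν]

theorem weightLaw_lt_iInf_child {n : ℕ} (v : Vertex f n) (s : ℝ≥0) :
    weightLaw ν f {w | (s : ℝ≥0∞) < ⨅ i, (w ⟨n, child v i⟩ : ℝ≥0∞)} ≤ ν (Set.Ioi s) ^ f n := by
  have hinj : Function.Injective fun i : Fin (f n) => (⟨n, child v i⟩ : Edge f) :=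
    fun i j hij => child_injective v (by simpa using hij)
  calc _ ≤ weightLaw ν f (Set.pi (Finset.univ.map ⟨_, hinj⟩ : Finset (Edge f))
        fun _ => Set.Ioi s) := measure_mono fun w hw e he => by
        obtain ⟨i, -, rfl⟩ := Finset.mem_map.1 (Finset.mem_coe.1 he)
        have h1 : (s : ℝ≥0∞) < w ⟨n, child v i⟩ := lt_of_lt_of_le hw (iInf_le _ i)
        exact_mod_cast h1
    _ = _ := by
        rw [Measure.infinitePi_pi _ fun _ _ => measurableSet_Ioi]
        simp

/-- The minimizer `v` depends on `w` alone, so `w'` can be integrated out with `v` fixed. -/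
theorem minWeight_splice_succ_le (hf_pos : ∀ n, 0 < f n) (x₀ : ℝ≥0) (n : ℕ) (w : Edge f → ℝ≥0) :
    ∃ v : Vertex f n, ∀ w' : Edge f → ℝ≥0,
      minWeight (fun e => min x₀ (splice n w w' e)) (n + 1) ≤
        minWeight (fun e => min x₀ (w e)) n +
          min (x₀ : ℝ≥0∞) (⨅ i, (w' ⟨n, child v i⟩ : ℝ≥0∞)) := by
  have : Nonempty (Vertex f n) := ⟨fun i => ⟨0, hf_pos i⟩⟩
  have : Nonempty (Fin (f n)) := ⟨⟨0, hf_pos n⟩⟩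
  obtain ⟨v, hv⟩ := exists_eq_ciInf_of_finite
    (f := fun v : Vertex f n => (pathWeight (fun e => min x₀ (w e)) v : ℝ≥0∞))
  refine ⟨v, fun w' => ?_⟩
  obtain ⟨i, hi⟩ := exists_eq_ciInf_of_finite
    (f := fun i : Fin (f n) => (w' ⟨n, child v i⟩ : ℝ≥0∞))
  rw [← hi, minWeight, minWeight, ← hv]
  refine (iInf_le _ (child v i)).trans (le_of_eq ?_)
  rw [pathWeight_child, pathWeight_congr (w' := fun e => min x₀ (w e)) fun e he => by
    simp [splice, he]]
  simp [splice]

theorem lintegral_minWeight_succ_le (hf_pos : ∀ n, 0 < f n) {x₀ : ℝ≥0} {n : ℕ} {r : ℝ≥0∞}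
    (hr : ∀ v : Vertex f n, ∫⁻ w, min (x₀ : ℝ≥0∞) (⨅ i, (w ⟨n, child v i⟩ : ℝ≥0∞))
      ∂weightLaw ν f ≤ r) :
    ∫⁻ w, minWeight (fun e => min x₀ (w e)) (n + 1) ∂weightLaw ν f ≤
      ∫⁻ w, minWeight (fun e => min x₀ (w e)) n ∂weightLaw ν f + r := by
  have hmin : ∀ k, Measurable fun w : Edge f → ℝ≥0 => minWeight (fun e => min x₀ (w e)) k :=
    fun k => (measurable_minWeight k).comp (measurable_pi_lambda _ fun e => by fun_prop)
  have hsp := measurePreserving_splice (f := f) ν n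
  rw [← hsp.lintegral_comp (hmin (n + 1)),
    lintegral_prod (fun p : (Edge f → ℝ≥0) × (Edge f → ℝ≥0) =>
      minWeight (fun e => min x₀ (splice n p.1 p.2 e)) (n + 1))
      ((hmin (n + 1)).comp hsp.measurable).aemeasurable]
  have hconst : ∫⁻ _ : Edge f → ℝ≥0, r ∂weightLaw ν f = r := by simp
  rw [← hconst, ← lintegral_add_left (hmin n)]
  refine lintegral_mono fun w => ?_
  obtain ⟨v, hv⟩ := minWeight_splice_succ_le hf_pos x₀ n w
  refine (lintegral_mono hv).trans ?_
  rw [lintegral_add_left measurable_const, lintegral_const, measure_univ, mul_one]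
  gcongr
  exact hr v

theorem gExplosive_of_gSmall (hν : ControlledNearZero ν) (hf_pos : ∀ n, 0 < f n)
    (hs : GSmall ν f) : GExplosive ν f := by
  obtain ⟨a, b, c, x₀, h⟩ := hν.exists_controlledBy
  obtain ⟨K, hK, hmin⟩ := h.exists_lintegral_min_le
  obtain ⟨N, hN⟩ := hs
  set m : ℕ → (Edge f → ℝ≥0) → ℝ≥0∞ := fun n w => minWeight (fun e => min x₀ (w e)) n with hm
  have hmm : ∀ k, Measurable (m k) :=
    fun k => (measurable_minWeight k).comp (measurable_pi_lambda _ fun e => by fun_prop)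
  have hstep : ∀ n, ∫⁻ w, m (n + 1) w ∂weightLaw ν f ≤
      ∫⁻ w, m n w ∂weightLaw ν f + K * quantile ν (f n : ℝ≥0∞)⁻¹ := fun n =>
    lintegral_minWeight_succ_le hf_pos fun v => hmin (weightLaw ν f) (f n) _ (hf_pos n)
      (.iInf fun i => .coe_nnreal_ennreal (measurable_pi_apply (⟨n, child v i⟩ : Edge f)))
      fun s => weightLaw_lt_iInf_child v s
  -- Truncation makes the first `N` generations cost at most `x₀` each, even where the quantile is
  -- infinite.
  have hbound : ∀ k, ∫⁻ w, m (k + N) w ∂weightLaw ν f ≤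
      N * x₀ + K * ∑ j ∈ Finset.range k, quantile ν (f (j + N) : ℝ≥0∞)⁻¹ := fun k => by
    induction k with
    | zero =>
      simp only [zero_add, Finset.range_zero, Finset.sum_empty, mul_zero, add_zero]
      refine (lintegral_mono fun w => minWeight_le_mul hf_pos (fun e => min_le_left _ _) N).trans ?_
      simp
    | succ k ih =>
      rw [Finset.sum_range_succ, mul_add, ← add_assoc, add_right_comm]
      exact (hstep (k + N)).trans (by gcongr)
  set C : ℝ≥0∞ := N * x₀ + K * ∑' j, quantile ν (f (j + N) : ℝ≥0∞)⁻¹ with hC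
  have hCt : C ≠ ∞ := by finiteness
  have hmono : Monotone m := fun i j hij w => minWeight_mono _ hij
  have hsup : ∫⁻ w, ⨆ n, m n w ∂weightLaw ν f ≤ C := by
    rw [lintegral_iSup hmm hmono]
    refine iSup_le fun n => (lintegral_mono (hmono (Nat.le_add_right n N))).trans
      ((hbound n).trans ?_)
    rw [hC]
    gcongr
    exact ENNReal.sum_le_tsum _
  filter_upwards [ae_lt_top (.iSup hmm) (ne_top_of_le_ne_top hCt hsup)] with w hw
  refine explosive_of_minWeight_min_le hf_pos h.x₀_pos (L := (⨆ n, m n w).toNNReal) fun n => ?_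
  rw [ENNReal.coe_toNNReal hw.ne]
  exact le_iSup (fun n => m n w) n

end Greedy

end SphericalTree

theorem theorem2 (ν : MeasureTheory.Measure ℝ≥0) [MeasureTheory.IsProbabilityMeasure ν]
    (hν : SphericalTree.ControlledNearZero ν)
    (f : ℕ → ℕ) (hf_pos : ∀ n, 0 < f n) (hf_mono : Monotone f) :
    SphericalTree.GSmall ν f ↔ SphericalTree.GExplosive ν f :=
  ⟨SphericalTree.gExplosive_of_gSmall hν hf_pos, fun he => by
    by_contra hs
    exact SphericalTree.not_gExplosive_of_not_gSmall hν hf_mono hs he⟩
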